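/- Call a group \emph{locally finite} if each of its finite subsets generates a finite subgroup. \emph{Philip Hall's universal locally finite group} is the countably infinite locally finite group $\mathbb{H}$, determined up to isomorphism, such that (i) every finite group embeds in $\mathbb{H}$, and (ii) any two isomorphic finite subgroups of $\mathbb{H}$ are conjugate in $\mathbb{H}$. Let $\mathrm{Aut}(\mathbb{H})$ carry the topology inherited from the product topology on $\mathbb{H}^{\mathbb{H}}$ with $\mathbb{H}$ discrete. \textbf{Theorem.} A countably infinite locally finite group with properties (i) and (ii) exists, and for every such group $\mathbb{H}$ the automorphism group $\mathrm{Aut}(\mathbb{H})$ has ample generics; that is, $\mathrm{Aut}(\mathbb{H})$ is a Polish group and for every $n\in\mathbb{N}$ the diagonal conjugation action of $\mathrm{Aut}(\mathbb{H})$ on $\mathrm{Aut}(\mathbb{H})^n$, $$g\cdot(h_1,\dots,h_n)=(gh_1g^{-1},\dots,gh_ng^{-1}),$$ has a comeager orbit (an orbit containing a countable intersection of dense open subsets of $\mathrm{Aut}(\mathbb{H})^n$). -/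

import Mathlib

/-- A group is locally finite if each of its finite subsets generates a finite subgroup. -/
def IsLocallyFiniteGroup (H : Type*) [Group H] : Prop :=
  ∀ s : Set H, s.Finite → Finite (Subgroup.closure s)

/-- The properties that determine Philip Hall's universal locally finite group up to isomorphism:
it is a countably infinite locally finite group, every finite group embeds in it, and any two
isomorphic finite subgroups of it are conjugate. Finite groups in `Type` represent all finite
groups up to isomorphism. -/
structure IsHallUniversalGroup (H : Type*) [Group H] : Prop where
  countable : Countable H
  infinite : Infinite H
  locallyFinite : IsLocallyFiniteGroup H
  embeds : ∀ (F : Type) [Group F] [Finite F], ∃ f : F →* H, Function.Injective f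
  conjugate : ∀ A B : Subgroup H, Finite A → Finite B → Nonempty (A ≃* B) →
    ∃ g : H, A.map (MulAut.conj g).toMonoidHom = B

/-- The topology on the automorphism group of a discrete group `H`: the one inherited from the
product topology on `H → H`, where each factor `H` is discrete. -/
instance MulAut.instTopologicalSpacePointwise (H : Type*) [Group H] :
    TopologicalSpace (MulAut H) :=
  TopologicalSpace.induced (fun (φ : MulAut H) (x : H) => φ x)
    (@Pi.topologicalSpace H (fun _ => H) (fun _ => ⊥))

/-- The orbit of `(h₁, …, hₙ)` under the diagonal conjugation action
`g • (h₁, …, hₙ) = (g h₁ g⁻¹, …, g hₙ g⁻¹)` of `G` on `Gⁿ`. -/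
def diagonalConjOrbit {G : Type*} [Group G] {n : ℕ} (h : Fin n → G) : Set (Fin n → G) :=
  Set.range fun (g : G) (i : Fin n) => g * h i * g⁻¹

/-- `G` is a Polish group with ample generics: for every `n`, the diagonal conjugation action of
`G` on `Gⁿ` has a comeager orbit. -/
structure HasAmpleGenerics (G : Type*) [Group G] [TopologicalSpace G] : Prop where
  isTopologicalGroup : IsTopologicalGroup G
  polishSpace : PolishSpace G
  exists_comeager_orbit : ∀ n : ℕ, ∃ h : Fin n → G, diagonalConjOrbit h ∈ residual (Fin n → G)

/-! Existence: isomorphic subgroups of a finite group `G` become conjugate in `Equiv.Perm G` under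
the left regular representation, since both act freely with equally many orbits. Iterating this
representation gives an ascending union with both properties.

Ample generics: in Hall's group every isomorphism between finite subgroups is induced by conjugation
(`exists_conj_eq`), so tuples of automorphisms are approximated on finite sets by inner ones. Finite
subgroups with prescribed inner actions amalgamate over a common invariant subgroup
(`exists_amalgam`), and the argument becomes a Fraïssé construction. The tuples in `IsGenericTuple`
play the role of the limit: they are comeager, being cut out by countably many dense open
conditions, and any two are conjugate by back-and-forth. Hence one orbit contains them all. -/

/-! ### Regular representations and ascending unions -/

/-- Isomorphic subgroups of a finite group act by left multiplication in the same way, up to a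
permutation of the group. -/
theorem Subgroup.exists_perm_intertwining {G : Type*} [Group G] [Finite G] {A B : Subgroup G}
    (θ : A ≃* B) : ∃ p : Equiv.Perm G, ∀ (a : A) (x : G), p (a * x) = θ a * p x := by
  -- `S` and `T` represent the orbits of the two free actions; matching representatives determines
  -- an intertwining permutation.
  obtain ⟨S, hS, -⟩ := A.exists_isComplement_right 1
  obtain ⟨T, hT, -⟩ := B.exists_isComplement_right 1
  have hcard : Nat.card S = Nat.card T := by
    have h1 := hS.card_mul_card
    have h2 := hT.card_mul_card
    have h3 : Nat.card A = Nat.card B := Nat.card_congr θ.toEquiv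
    have h4 : 0 < Nat.card A := Nat.card_pos
    refine Nat.eq_of_mul_eq_mul_left h4 ?_
    conv_rhs => rw [h3]
    exact h1.trans h2.symm
  obtain ⟨τ⟩ : Nonempty (S ≃ T) := Finite.card_eq.1 hcard
  refine ⟨hS.equiv.trans ((θ.toEquiv.prodCongr τ).trans hT.equiv.symm), fun a x => ?_⟩
  simp only [Equiv.trans_apply, Equiv.prodCongr_apply]
  apply hT.equiv.injective
  rw [Subgroup.IsComplement.equiv_mul_left, Subgroup.IsComplement.equiv_mul_left]
  simp [Prod.map]

/-- The left regular representation of a group conjugates isomorphic subgroups of a finite group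
into each other. -/
theorem Subgroup.exists_conj_map_toPermHom {G : Type*} [Group G] [Finite G] {A B : Subgroup G}
    (h : Nonempty (A ≃* B)) : ∃ p : Equiv.Perm G,
      (A.map (MulAction.toPermHom G G)).map (MulAut.conj p).toMonoidHom =
        B.map (MulAction.toPermHom G G) := by
  obtain ⟨θ⟩ := h
  obtain ⟨p, hp⟩ := Subgroup.exists_perm_intertwining θ
  have key : ∀ a : A, p * MulAction.toPermHom G G a * p⁻¹ = MulAction.toPermHom G G (θ a : G) := by
    intro a
    ext x
    simp [hp, Equiv.Perm.mul_apply]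
  refine ⟨p, le_antisymm ?_ ?_⟩
  · rintro _ ⟨_, ⟨a, ha, rfl⟩, rfl⟩
    exact ⟨θ ⟨a, ha⟩, (θ ⟨a, ha⟩).2, (key ⟨a, ha⟩).symm⟩
  · rintro _ ⟨b, hb, rfl⟩
    refine ⟨_, ⟨θ.symm ⟨b, hb⟩, (θ.symm ⟨b, hb⟩).2, rfl⟩, ?_⟩
    simpa using key (θ.symm ⟨b, hb⟩)

theorem Subgroup.map_conj_map {G H : Type*} [Group G] [Group H] (f : G →* H) (A : Subgroup G)
    (g : G) : (A.map f).map (MulAut.conj (f g)).toMonoidHom =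
      (A.map (MulAut.conj g).toMonoidHom).map f := by
  rw [Subgroup.map_map, Subgroup.map_map]
  congr 1
  ext x
  simp

/-- A union of an ascending sequence of finite groups is Hall's universal group if every finite
group embeds in a member and isomorphic subgroups of each member are conjugate in the union. -/
theorem IsHallUniversalGroup.of_ascending_union {H : Type*} [Group H] {G : ℕ → Type*}
    [∀ k, Group (G k)] [∀ k, Finite (G k)] (ι : ∀ k, G k →* H)
    (inj : ∀ k, Function.Injective (ι k)) (mono : Monotone fun k => (ι k).range)
    (surj : ∀ h, ∃ k, h ∈ (ι k).range)
    (emb : ∀ (F : Type) [Group F] [Finite F], ∃ k, ∃ f : F →* G k, Function.Injective f)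
    (conj : ∀ k (A B : Subgroup (G k)), Nonempty (A ≃* B) →
      ∃ g : H, (A.map (ι k)).map (MulAut.conj g).toMonoidHom = B.map (ι k)) :
    IsHallUniversalGroup H := by
  have cover : ∀ s : Set H, s.Finite → ∃ k, s ⊆ (ι k).range := by
    intro s hs
    induction s, hs using Set.Finite.induction_on with
    | empty => exact ⟨0, Set.empty_subset _⟩
    | @insert a s _ _ ih =>
      obtain ⟨k, hk⟩ := ih
      obtain ⟨l, hl⟩ := surj a
      refine ⟨max k l, Set.insert_subset (mono (le_max_right k l) hl) fun x hx => ?_⟩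
      exact mono (le_max_left k l) (hk hx)
  have embH : ∀ (F : Type) [Group F] [Finite F], ∃ f : F →* H, Function.Injective f := by
    intro F _ _
    obtain ⟨k, f, hf⟩ := emb F
    exact ⟨(ι k).comp f, (inj k).comp hf⟩
  have pull : ∀ k (A : Subgroup H), A ≤ (ι k).range →
      Nonempty (A ≃* A.comap (ι k)) ∧ (A.comap (ι k)).map (ι k) = A := by
    intro k A hA
    have h : (A.comap (ι k)).map (ι k) = A := Subgroup.map_comap_eq_self hA
    refine ⟨⟨?_⟩, h⟩
    exact (MulEquiv.subgroupCongr h.symm).trans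
      ((A.comap (ι k)).equivMapOfInjective (ι k) (inj k)).symm
  refine ⟨?_, ?_, ?_, embH, ?_⟩
  · have hs : Function.Surjective (fun x : Σ k, G k => ι x.1 x.2) := by
      intro h
      obtain ⟨k, x, hx⟩ := surj h
      exact ⟨⟨k, x⟩, hx⟩
    exact hs.countable
  · by_contra hfin
    rw [not_infinite_iff_finite] at hfin
    -- A cyclic group with one element more than `H` could not embed.
    obtain ⟨f, hf⟩ := embH (Multiplicative (ZMod (Nat.card H + 1)))
    have := Nat.card_le_card_of_injective f hf
    simp at this
  · intro s hs
    obtain ⟨k, hk⟩ := cover s hs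
    have : Finite (ι k).range := Finite.of_surjective _ (ι k).rangeRestrict_surjective
    exact Finite.of_injective _ (Subgroup.inclusion_injective ((Subgroup.closure_le _).2 hk))
  · rintro A B hA hB ⟨e⟩
    obtain ⟨k, hk⟩ := cover (A ∪ B) (Set.Finite.union (Set.toFinite _) (Set.toFinite _))
    obtain ⟨⟨eA⟩, hA'⟩ := pull k A fun x hx => hk (Or.inl hx)
    obtain ⟨⟨eB⟩, hB'⟩ := pull k B fun x hx => hk (Or.inr hx)
    obtain ⟨g, hg⟩ := conj k _ _ ⟨eA.symm.trans (e.trans eB)⟩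
    rw [hA', hB'] at hg
    exact ⟨g, hg⟩

/-! ### The tower of symmetric groups and its limit -/

/-- The iterated symmetric groups over a three-element set, as bundled groups. -/
def symTowerGrp : ℕ → GrpCat.{0}
  | 0 => GrpCat.of (Equiv.Perm (Fin 3))
  | k + 1 => GrpCat.of (Equiv.Perm (symTowerGrp k))

/-- The iterated symmetric groups over a three-element set. -/
def SymTower (k : ℕ) : Type := symTowerGrp k

instance (k : ℕ) : Group (SymTower k) := inferInstanceAs (Group (symTowerGrp k))

/-- The left regular representation, from each of the iterated symmetric groups to the next. -/
def symTowerStep (k : ℕ) : SymTower k →* SymTower (k + 1) :=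
  MulAction.toPermHom (SymTower k) (SymTower k)

theorem symTowerStep_injective (k : ℕ) : Function.Injective (symTowerStep k) :=
  MulAction.toPerm_injective

instance symTower_finite (k : ℕ) : Finite (SymTower k) := by
  induction k with
  | zero => exact inferInstanceAs (Finite (Equiv.Perm (Fin 3)))
  | succ k ih => exact inferInstanceAs (Finite (Equiv.Perm (SymTower k)))

/-- Unbounded orders let every finite group fit into some stage. The strict growth `n < n!` starts
only at `n = 3`; a tower begun with a group of order two would be stationary. -/
theorem add_three_le_card_symTower (k : ℕ) : k + 3 ≤ Nat.card (SymTower k) := by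
  induction k with
  | zero =>
    have : Nat.card (SymTower 0) = 6 := by
      change Nat.card (Equiv.Perm (Fin 3)) = 6
      rw [Nat.card_perm]; simp [Nat.factorial]
    omega
  | succ k ih =>
    have : Nat.card (SymTower (k + 1)) = (Nat.card (SymTower k)).factorial := by
      change Nat.card (Equiv.Perm (SymTower k)) = _
      rw [Nat.card_perm]
    have h2 := Nat.lt_factorial_self ((Nat.le_add_left 3 k).trans ih)
    omega

/-- The embedding of an iterated symmetric group in a later one. -/
def symTowerMap (i j : ℕ) (h : i ≤ j) : SymTower i →* SymTower j :=
  Nat.leRecOn (C := fun k => SymTower i →* SymTower k) h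
    (fun {k} g => (symTowerStep k).comp g) (MonoidHom.id _)

theorem symTowerMap_self (i : ℕ) : symTowerMap i i le_rfl = MonoidHom.id _ :=
  Nat.leRecOn_self _

theorem symTowerMap_succ (i j : ℕ) (h : i ≤ j) :
    symTowerMap i (j + 1) (h.trans j.le_succ) = (symTowerStep j).comp (symTowerMap i j h) :=
  Nat.leRecOn_succ h _

theorem symTowerMap_injective (i j : ℕ) (h : i ≤ j) : Function.Injective (symTowerMap i j h) := by
  induction j, h using Nat.le_induction with
  | base => rw [symTowerMap_self]; exact Function.injective_id
  | succ j h ih => rw [symTowerMap_succ i j h]; exact (symTowerStep_injective j).comp ih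

instance symTower_directedSystem :
    DirectedSystem SymTower (fun i j h => symTowerMap i j h) where
  map_self i x := by rw [symTowerMap_self]; rfl
  map_map k j i hij hjk x := by
    induction k, hjk using Nat.le_induction with
    | base => rw [symTowerMap_self]; rfl
    | succ k hjk ih =>
      rw [symTowerMap_succ j k hjk, symTowerMap_succ i k (hij.trans hjk)]
      exact congrArg (symTowerStep k) ih

/-- Hall's universal locally finite group, as the direct limit of iterated symmetric groups. -/
abbrev HallGroup : Type := DirectLimit SymTower symTowerMap

/-- The embedding of an iterated symmetric group in the direct limit. -/
def HallGroup.of (k : ℕ) : SymTower k →* HallGroup where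
  toFun x := ⟦⟨k, x⟩⟧
  map_one' := (DirectLimit.one_def k).symm
  map_mul' x y := (DirectLimit.mul_def k x y).symm

theorem HallGroup.of_injective (k : ℕ) : Function.Injective (HallGroup.of k) :=
  DirectLimit.mk_injective _ symTowerMap_injective k

theorem HallGroup.of_symTowerMap {i j : ℕ} (h : i ≤ j) (x : SymTower i) :
    HallGroup.of j (symTowerMap i j h x) = HallGroup.of i x :=
  DirectLimit.mk_apply i j x h

theorem HallGroup.of_symTowerStep (k : ℕ) :
    (HallGroup.of (k + 1)).comp (symTowerStep k) = HallGroup.of k := by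
  ext x
  rw [← HallGroup.of_symTowerMap k.le_succ x, symTowerMap_succ k k le_rfl, symTowerMap_self]
  rfl

theorem HallGroup.isHallUniversalGroup : IsHallUniversalGroup HallGroup := by
  refine .of_ascending_union HallGroup.of HallGroup.of_injective ?_ ?_ ?_ ?_
  · rintro i j h _ ⟨x, rfl⟩
    exact ⟨symTowerMap i j h x, HallGroup.of_symTowerMap h x⟩
  · intro h
    obtain ⟨k, x, rfl⟩ := DirectLimit.exists_eq_mk _ h
    exact ⟨k, x, rfl⟩
  · intro F _ _
    have hcard : Nat.card F ≤ Nat.card (SymTower (Nat.card F)) :=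
      (Nat.le_add_right _ _).trans (add_three_le_card_symTower _)
    obtain ⟨ε⟩ : Nonempty (F ↪ SymTower (Nat.card F)) := by
      have := Fintype.ofFinite F
      have := Fintype.ofFinite (SymTower (Nat.card F))
      exact Function.Embedding.nonempty_of_card_le (by
        rwa [← Nat.card_eq_fintype_card, ← Nat.card_eq_fintype_card])
    -- Cayley's theorem puts `F` in `Equiv.Perm F`, and the injection `ε` of underlying sets carries
    -- this into the next stage.
    exact ⟨Nat.card F + 1, (Equiv.Perm.viaEmbeddingHom ε).comp (MulAction.toPermHom F F),
      (Equiv.Perm.viaEmbeddingHom_injective ε).comp MulAction.toPerm_injective⟩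
  · intro k A B hAB
    obtain ⟨p, hp⟩ : ∃ p : SymTower (k + 1),
        (A.map (symTowerStep k)).map (MulAut.conj p).toMonoidHom = B.map (symTowerStep k) :=
      Subgroup.exists_conj_map_toPermHom (G := SymTower k) hAB
    refine ⟨HallGroup.of (k + 1) p, ?_⟩
    rw [← HallGroup.of_symTowerStep k, ← Subgroup.map_map, ← Subgroup.map_map,
      Subgroup.map_conj_map, hp]

/-! ### Homogeneity and amalgamation in Hall's group -/

/-- The second coordinate recovers the element of `K`, after which injectivity of `d` recovers that
of `A`; so `p` need not be injective. -/
theorem SemidirectProduct.exists_injective_lift_prod {A K D : Type*} [Group A] [Group K] [Group D]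
    (act : K →* MulAut A) (d : A →* D) (p : K →* D) (hd : Function.Injective d)
    (hdp : ∀ k a, p k * d a = d (act k a) * p k) :
    ∃ E : A ⋊[act] K →* D × K, Function.Injective E ∧
      (∀ a, E (SemidirectProduct.inl a) = (d a, 1)) ∧
      ∀ k, E (SemidirectProduct.inr k) = (p k, k) := by
  refine ⟨SemidirectProduct.lift ((MonoidHom.inl D K).comp d) (p.prod (MonoidHom.id K)) ?_,
    ?_, ?_, ?_⟩
  · intro k
    ext a
    · simp [hdp]
    · simp
  · rintro ⟨a, k⟩ ⟨a', k'⟩ h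
    simp only [SemidirectProduct.lift, MonoidHom.coe_mk, OneHom.coe_mk, MonoidHom.comp_apply,
      MonoidHom.inl_apply, MonoidHom.prod_apply, MonoidHom.id_apply, Prod.mk_mul_mk,
      Prod.mk.injEq, one_mul] at h
    obtain ⟨h1, rfl⟩ := h
    rw [hd (mul_right_cancel h1)]
  · intro a
    simp
  · intro k
    simp

namespace IsHallUniversalGroup

variable {H : Type*} [Group H]

/-- Finite groups in any universe embed in Hall's universal group. -/
theorem exists_injective_hom (hH : IsHallUniversalGroup H) (F : Type*) [Group F] [Finite F] :
    ∃ f : F →* H, Function.Injective f := by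
  have ε : Shrink.{0} F ≃* F := Shrink.mulEquiv
  have : Finite (Shrink.{0} F) := Finite.of_equiv F ε.symm.toEquiv
  obtain ⟨f, hf⟩ := hH.embeds (Shrink.{0} F)
  exact ⟨f.comp ε.symm.toMonoidHom, hf.comp ε.symm.injective⟩

/-- Automorphisms of finite subgroups of Hall's universal group are induced by inner
automorphisms. -/
theorem exists_conj_eq_mulAut (hH : IsHallUniversalGroup H) (A : Subgroup H) [Finite A]
    (α : MulAut A) :
    ∃ g : H, ∀ a : A, g * a * g⁻¹ = α a := by
  have : Finite (MulAut A) := DFunLike.finite _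
  have : Finite (A ⋊[MonoidHom.id (MulAut A)] MulAut A) :=
    Finite.of_equiv _ SemidirectProduct.equivProd.symm
  -- In the holomorph every automorphism of `A` is a conjugation.
  obtain ⟨f, hf⟩ := hH.exists_injective_hom (A ⋊[MonoidHom.id (MulAut A)] MulAut A)
  let u : A →* H := f.comp SemidirectProduct.inl
  have hu : Function.Injective u := hf.comp SemidirectProduct.inl_injective
  have : Finite u.range := Finite.of_surjective _ u.rangeRestrict_surjective
  obtain ⟨t, ht⟩ := hH.conjugate u.range A inferInstance inferInstance
    ⟨(MonoidHom.ofInjective hu).symm⟩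
  have ht' : ∀ x : A, t * u x * t⁻¹ ∈ A := by
    intro x
    exact ht.le ⟨u x, ⟨x, rfl⟩, by simp⟩
  let v : A →* A := ((MulAut.conj t).toMonoidHom.comp u).codRestrict A ht'
  have hv : Function.Bijective v := by
    refine Finite.injective_iff_bijective.1 fun x y hxy => hu ?_
    simpa [v] using congrArg Subtype.val hxy
  let w : MulAut A := MulEquiv.ofBijective v hv
  -- Moving the embedded copy back onto `A` introduces the automorphism `w`, for which this twist
  -- compensates.
  let β : MulAut A := w⁻¹ * α * w
  refine ⟨t * f (SemidirectProduct.inr β) * t⁻¹, fun a => ?_⟩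
  obtain ⟨x, rfl⟩ := hv.2 a
  have h1 : ((v x : A) : H) = t * u x * t⁻¹ := rfl
  have h2 : α (v x) = v (β x) := (w.apply_symm_apply _).symm
  have h3 : u (β x) = f (SemidirectProduct.inr β) * u x * (f (SemidirectProduct.inr β))⁻¹ := by
    have := SemidirectProduct.inl_aut (φ := MonoidHom.id (MulAut A)) β x
    simp only [MonoidHom.id_apply] at this
    simp [u, this]
  have h4 : ((v (β x) : A) : H) = t * u (β x) * t⁻¹ := rfl
  rw [h2, h4, h3, h1]
  group

/-- Two embeddings of a finite group in Hall's universal group differ by an inner automorphism. -/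
theorem exists_conj_eq (hH : IsHallUniversalGroup H) {F : Type*} [Group F] [Finite F] {u v : F →* H}
    (hu : Function.Injective u) (hv : Function.Injective v) :
    ∃ g : H, ∀ x, g * u x * g⁻¹ = v x := by
  have : Finite u.range := Finite.of_surjective _ u.rangeRestrict_surjective
  have : Finite v.range := Finite.of_surjective _ v.rangeRestrict_surjective
  obtain ⟨t, ht⟩ := hH.conjugate u.range v.range inferInstance inferInstance
    ⟨(MonoidHom.ofInjective hu).symm.trans (MonoidHom.ofInjective hv)⟩
  have ht' : ∀ x, t * u x * t⁻¹ ∈ v.range := by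
    intro x
    exact ht.le ⟨u x, ⟨x, rfl⟩, by simp⟩
  let w : F →* v.range := ((MulAut.conj t).toMonoidHom.comp u).codRestrict _ ht'
  have hw : Function.Injective w := by
    refine fun x y hxy => hu ?_
    simpa [w] using congrArg Subtype.val hxy
  let vr := MonoidHom.ofInjective hv
  have hbij : Function.Bijective (vr.symm.toMonoidHom.comp w) :=
    Finite.injective_iff_bijective.1 (vr.symm.injective.comp hw)
  let e : MulAut F := MulEquiv.ofBijective _ hbij
  -- Conjugation by `t` matches `u` with `v` only up to the automorphism `e`; a second conjugation
  -- undoes `e`.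
  obtain ⟨g, hg⟩ := hH.exists_conj_eq_mulAut v.range ((vr.symm.trans e.symm).trans vr)
  refine ⟨g * t, fun x => ?_⟩
  have h1 := hg (w x)
  have h2 : ((vr.symm.trans e.symm).trans vr) (w x) = vr x :=
    congrArg vr (e.symm_apply_apply x)
  rw [h2] at h1
  have h3 : ((w x : v.range) : H) = t * u x * t⁻¹ := rfl
  rw [h3] at h1
  rw [← show ((vr x : v.range) : H) = v x from rfl, ← h1]
  group

/-- Hall's universal group is injective among finite groups. -/
theorem exists_extension (hH : IsHallUniversalGroup H) {E P : Type*} [Group E] [Group P]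
    [Finite P] {e : E →* P} {u : E →* H}
    (he : Function.Injective e) (hu : Function.Injective u) :
    ∃ v : P →* H, Function.Injective v ∧ ∀ x, v (e x) = u x := by
  have : Finite E := Finite.of_injective e he
  obtain ⟨f, hf⟩ := hH.exists_injective_hom P
  obtain ⟨g, hg⟩ := hH.exists_conj_eq (u := f.comp e) (hf.comp he) hu
  exact ⟨(MulAut.conj g).toMonoidHom.comp f, (MulAut.conj g).injective.comp hf, hg⟩

/-- Amalgamation of finite groups with inner automorphisms in Hall's universal group. -/
theorem exists_amalgam (hH : IsHallUniversalGroup H) {A B C ι : Type*} [Group A] [Group B]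
    [Group C] [Finite B] [Finite C]
    {e : A →* B} {i : A →* C} {c : C →* H} (he : Function.Injective e)
    (hi : Function.Injective i) (hc : Function.Injective c) (α : ι → MulAut A) {b : ι → B}
    {g : ι → C} (hb : ∀ s a, b s * e a * (b s)⁻¹ = e (α s a))
    (hg : ∀ s a, g s * i a * (g s)⁻¹ = i (α s a)) :
    ∃ (h : ι → H) (j : B →* H), Function.Injective j ∧ (∀ a, j (e a) = c (i a)) ∧
      (∀ s x, h s * c x * (h s)⁻¹ = c (g s * x * (g s)⁻¹)) ∧
      ∀ s y, h s * j y * (h s)⁻¹ = j (b s * y * (b s)⁻¹) := by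
  -- `K` collects the triples whose parts in `B` and `C` induce the same automorphism of `A`. Then
  -- `A ⋊ K` embeds in both `B × K` and `C × K`, which are glued along it inside `H`.
  let K : Subgroup (MulAut A × B × C) :=
    { carrier := {k | ∀ a, k.2.1 * e a = e (k.1 a) * k.2.1 ∧ k.2.2 * i a = i (k.1 a) * k.2.2}
      one_mem' := by intro a; simp
      mul_mem' := by
        intro x y hx hy a
        constructor
        · simp only [Prod.snd_mul, Prod.fst_mul, MulAut.mul_apply]
          rw [mul_assoc, (hy a).1, ← mul_assoc, (hx _).1, mul_assoc]
        · simp only [Prod.snd_mul, Prod.fst_mul, MulAut.mul_apply]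
          rw [mul_assoc, (hy a).2, ← mul_assoc, (hx _).2, mul_assoc]
      inv_mem' := by
        intro x hx a
        obtain ⟨h1, h2⟩ := hx (x.1⁻¹ a)
        rw [MulAut.apply_inv_self] at h1 h2
        constructor
        · simp only [Prod.snd_inv, Prod.fst_inv]
          rw [inv_mul_eq_iff_eq_mul, ← mul_assoc, h1, mul_inv_cancel_right]
        · simp only [Prod.snd_inv, Prod.fst_inv]
          rw [inv_mul_eq_iff_eq_mul, ← mul_assoc, h2, mul_inv_cancel_right] }
  have : Finite A := Finite.of_injective e he
  have : Finite (MulAut A) := DFunLike.finite _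
  let act : K →* MulAut A := (MonoidHom.fst _ _).comp K.subtype
  let pB : K →* B := (MonoidHom.fst _ _).comp ((MonoidHom.snd _ _).comp K.subtype)
  let pC : K →* C := (MonoidHom.snd _ _).comp ((MonoidHom.snd _ _).comp K.subtype)
  obtain ⟨EB, hEB, hEBl, hEBr⟩ := SemidirectProduct.exists_injective_lift_prod act e pB he
    fun k a => (k.2 a).1
  obtain ⟨EC, hEC, hECl, hECr⟩ := SemidirectProduct.exists_injective_lift_prod act i pC hi
    fun k a => (k.2 a).2
  obtain ⟨v, hv, hvc⟩ := hH.exists_extension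
    (e := MonoidHom.inl C K) (u := c) (fun x y h => congrArg Prod.fst h) hc
  obtain ⟨w, hw, hwv⟩ := hH.exists_extension (u := v.comp EC) hEB (hv.comp hEC)
  -- The image of `κ s` is `(b s, κ s)` on one side and `(g s, κ s)` on the other. These coincide in
  -- `H`, so a single element induces both conjugations.
  let κ : ι → K := fun s => ⟨(α s, b s, g s), fun a =>
    ⟨mul_inv_eq_iff_eq_mul.1 (hb s a), mul_inv_eq_iff_eq_mul.1 (hg s a)⟩⟩
  have hκ : ∀ s, w (b s, κ s) = v (g s, κ s) := by
    intro s
    have h1 := hwv (SemidirectProduct.inr (κ s))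
    rwa [MonoidHom.comp_apply, hEBr, hECr] at h1
  refine ⟨fun s => v (g s, κ s), w.comp (MonoidHom.inl B K),
    hw.comp fun x y h => congrArg Prod.fst h, ?_, ?_, ?_⟩
  · intro a
    have h1 := hwv (SemidirectProduct.inl a)
    rw [MonoidHom.comp_apply, hEBl, hECl] at h1
    exact h1.trans (hvc (i a))
  · intro s x
    rw [← hvc, ← hvc, ← map_inv, ← map_mul, ← map_mul]
    simp
  · intro s y
    simp only [← hκ, MonoidHom.comp_apply]
    rw [← map_inv, ← map_mul, ← map_mul]
    simp

end IsHallUniversalGroup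

/-! ### Generic tuples and back-and-forth -/

/-- An automorphism restricts to a finite subgroup that it maps into itself. -/
theorem MulAut.exists_restrict {G : Type*} [Group G] (φ : MulAut G) (A : Subgroup G) [Finite A]
    (h : ∀ a ∈ A, φ a ∈ A) : ∃ α : MulAut A, ∀ a : A, (α a : G) = φ a := by
  let f : A →* A := (φ.toMonoidHom.comp A.subtype).codRestrict A fun a => h a a.2
  have hf : Function.Bijective f := by
    refine Finite.injective_iff_bijective.1 fun x y hxy => Subtype.ext (φ.injective ?_)
    exact congrArg Subtype.val hxy
  exact ⟨MulEquiv.ofBijective f hf, fun a => rfl⟩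

section PartialIso

variable {H ι : Type*} [Group H]

/-- The finite subgroup `B`, with the inner automorphisms given by `b`, embeds over its subgroup
`A` in the group with the automorphisms `φ`, provided that `A` with the restrictions of these
automorphisms does. -/
def RealizesExtension (A B : Subgroup H) (b : ι → B) (φ : ι → MulAut H) : Prop :=
  A ≤ B → (∀ i, ∀ a ∈ A, φ i a ∈ A ∧ φ i a = b i * a * (b i : H)⁻¹) →
    ∃ j : B →* H, Function.Injective j ∧ (∀ x : B, (x : H) ∈ A → j x = x) ∧
      ∀ i x, φ i (j x) = j (b i * x * (b i)⁻¹)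

/-- Tuples of automorphisms for which finite sets lie in finite invariant subgroups, and which
realize all finite extensions of these subgroups. -/
structure IsGenericTuple (φ : ι → MulAut H) : Prop where
  exists_invariant : ∀ s : Set H, s.Finite →
    ∃ C : Subgroup H, Finite C ∧ s ⊆ C ∧ ∀ i, ∀ x ∈ C, φ i x ∈ C
  realizes : ∀ (A B : Subgroup H), Finite B → ∀ b : ι → B, RealizesExtension A B b φ

/-- The graphs of isomorphisms between finite invariant subgroups that are equivariant for two
tuples of automorphisms. -/
structure IsEquivariantPartialIso (φ ψ : ι → MulAut H) (R : Subgroup (H × H)) : Prop where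
  finite : Finite R
  eq_one_iff : ∀ p ∈ R, p.1 = 1 ↔ p.2 = 1
  invariant : ∀ i, ∀ p ∈ R, (φ i p.1, ψ i p.2) ∈ R

namespace IsEquivariantPartialIso

variable {φ ψ : ι → MulAut H} {R : Subgroup (H × H)}

theorem bot : IsEquivariantPartialIso φ ψ ⊥ where
  finite := inferInstance
  eq_one_iff p hp := by rw [Subgroup.mem_bot.1 hp]; rfl
  invariant i p hp := by rw [Subgroup.mem_bot.1 hp, Subgroup.mem_bot]; simp

theorem swap (hR : IsEquivariantPartialIso φ ψ R) :
    IsEquivariantPartialIso ψ φ (R.comap (MulEquiv.prodComm (M := H) (N := H)).toMonoidHom) where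
  finite := by
    have := hR.finite
    exact Finite.of_injective (fun x => (⟨_, x.2⟩ : R)) fun x y hxy =>
      Subtype.ext (MulEquiv.prodComm.injective (congrArg Subtype.val hxy))
  eq_one_iff p hp := (hR.eq_one_iff _ hp).symm
  invariant i p hp := hR.invariant i _ hp

/-- The partial isomorphism extends to an embedding `k` of a finite invariant `C` containing `x`,
but `k` need not be equivariant. Inside a holomorph of `C` the restrictions of the `φ i` become
inner, so genericity of `ψ` yields an equivariant embedding that agrees with `k` on the old domain.
-/
theorem exists_ge (hR : IsEquivariantPartialIso φ ψ R) (hH : IsHallUniversalGroup H)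
    (hφ : IsGenericTuple φ) (hψ : IsGenericTuple ψ) (x : H) :
    ∃ R', R ≤ R' ∧ IsEquivariantPartialIso φ ψ R' ∧ ∃ y, (x, y) ∈ R' := by
  have := hR.finite
  obtain ⟨C, hC, hsC, hinv⟩ := hφ.exists_invariant
    (insert x (Prod.fst '' (R : Set (H × H)))) (((Set.toFinite _).image _).insert x)
  have hRC : ∀ p ∈ R, p.1 ∈ C := fun p hp => hsC (Or.inr ⟨p, hp, rfl⟩)
  let e : R →* C := ((MonoidHom.fst H H).comp R.subtype).codRestrict C fun p => hRC _ p.2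
  have he : Function.Injective e := by
    refine (injective_iff_map_eq_one e).2 fun p hp => ?_
    have h1 : (p : H × H).1 = 1 := congrArg Subtype.val hp
    exact Subtype.ext (Prod.ext h1 ((hR.eq_one_iff _ p.2).1 h1))
  let u : R →* H := (MonoidHom.snd H H).comp R.subtype
  have hu : Function.Injective u := by
    refine (injective_iff_map_eq_one u).2 fun p hp => ?_
    exact Subtype.ext (Prod.ext ((hR.eq_one_iff _ p.2).2 hp) hp)
  obtain ⟨k, hk, hke⟩ := hH.exists_extension he hu
  choose γ hγ using fun i => MulAut.exists_restrict (φ i) C (hinv i)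
  have : Finite (MulAut C) := DFunLike.finite _
  have : Finite (C ⋊[MonoidHom.id (MulAut C)] MulAut C) :=
    Finite.of_equiv _ SemidirectProduct.equivProd.symm
  obtain ⟨K, hK, hKk⟩ := hH.exists_extension
    (SemidirectProduct.inl_injective (φ := MonoidHom.id (MulAut C))) hk
  have : Finite K.range := Finite.of_surjective _ K.rangeRestrict_surjective
  have hconj : ∀ i c, K (SemidirectProduct.inr (γ i)) * k c * (K (SemidirectProduct.inr (γ i)))⁻¹ =
      k (γ i c) := by
    intro i c
    have := SemidirectProduct.inl_aut (φ := MonoidHom.id (MulAut C)) (γ i) c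
    rw [MonoidHom.id_apply] at this
    rw [← hKk, ← hKk, this]
    simp
  obtain ⟨j, hj, hjA, hjb⟩ := hψ.realizes u.range K.range inferInstance
    (fun i => K.rangeRestrict (SemidirectProduct.inr (γ i)))
    (by
      rintro _ ⟨p, rfl⟩
      exact ⟨SemidirectProduct.inl (e p), by rw [hKk, hke]⟩)
    (by
      rintro i _ ⟨p, rfl⟩
      have hp := hR.invariant i p p.2
      refine ⟨⟨⟨_, hp⟩, rfl⟩, ?_⟩
      have h1 : e ⟨_, hp⟩ = γ i (e p) := Subtype.ext (hγ i (e p)).symm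
      rw [← hke p]
      refine Eq.trans ?_ (hconj i (e p)).symm
      rw [← h1, hke, hke]
      rfl)
  let ℓ : C →* H := j.comp (K.rangeRestrict.comp SemidirectProduct.inl)
  have hℓ : Function.Injective ℓ := by
    have h : Function.Injective K.rangeRestrict := K.rangeRestrict_injective_iff.2 hK
    exact hj.comp (h.comp SemidirectProduct.inl_injective)
  have hℓψ : ∀ i c, ψ i (ℓ c) = ℓ (γ i c) := by
    intro i c
    refine (hjb i _).trans (congrArg j (Subtype.ext ?_))
    simpa [hKk] using hconj i c
  refine ⟨(C.subtype.prod ℓ).range, ?_, ⟨?_, ?_, ?_⟩, ?_⟩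
  · rintro ⟨a, b⟩ hp
    refine ⟨e ⟨_, hp⟩, Prod.ext rfl ?_⟩
    have h1 : K (SemidirectProduct.inl (e ⟨_, hp⟩)) = b := by
      rw [hKk, hke]
      rfl
    exact (hjA (K.rangeRestrict _) ⟨⟨_, hp⟩, h1.symm⟩).trans h1
  · exact Finite.of_surjective _ (C.subtype.prod ℓ).rangeRestrict_surjective
  · rintro _ ⟨c, rfl⟩
    change (c : H) = 1 ↔ ℓ c = 1
    rw [map_eq_one_iff ℓ hℓ, OneMemClass.coe_eq_one]
  · rintro i _ ⟨c, rfl⟩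
    exact ⟨γ i c, Prod.ext (hγ i c) (hℓψ i c).symm⟩
  · exact ⟨ℓ ⟨x, hsC (Or.inl rfl)⟩, ⟨x, hsC (Or.inl rfl)⟩, rfl⟩

end IsEquivariantPartialIso

/-- Any two generic tuples are conjugate, by a back-and-forth argument. -/
theorem IsGenericTuple.exists_conj {φ ψ : ι → MulAut H} (hH : IsHallUniversalGroup H)
    (hφ : IsGenericTuple φ) (hψ : IsGenericTuple ψ) :
    ∃ g : MulAut H, ∀ i, g * φ i * g⁻¹ = ψ i := by
  have := hH.countable
  have := Encodable.ofCountable H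
  let P := {R : Subgroup (H × H) // IsEquivariantPartialIso φ ψ R}
  -- Having `x` in the domain and having `y` in the range are countably many cofinal conditions, so
  -- one ideal of approximations meets them all.
  let D : H ⊕ H → Order.Cofinal P := Sum.elim
    (fun x =>
      { carrier := {R | ∃ y, (x, y) ∈ R.1}
        isCofinal := fun R => by
          obtain ⟨R', h, hR', hx⟩ := R.2.exists_ge hH hφ hψ x
          exact ⟨⟨R', hR'⟩, hx, h⟩ })
    (fun y =>
      { carrier := {R | ∃ x, (x, y) ∈ R.1}
        isCofinal := fun R => by
          obtain ⟨R', h, hR', x, hx⟩ := R.2.swap.exists_ge hH hψ hφ y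
          exact ⟨⟨_, hR'.swap⟩, ⟨x, hx⟩, fun p hp => h (x := p.swap) hp⟩ })
  let I := Order.idealOfCofinals (⟨⊥, .bot⟩ : P) D
  let S : H → H → Prop := fun x y => ∃ R ∈ I, (x, y) ∈ R.1
  have hleft : ∀ x, ∃ y, S x y := fun x => by
    obtain ⟨R, ⟨y, hy⟩, hR⟩ := Order.cofinal_meets_idealOfCofinals (⟨⊥, .bot⟩ : P) D (.inl x)
    exact ⟨y, R, hR, hy⟩
  have hright : ∀ y, ∃ x, S x y := fun y => by
    obtain ⟨R, ⟨x, hx⟩, hR⟩ := Order.cofinal_meets_idealOfCofinals (⟨⊥, .bot⟩ : P) D (.inr y)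
    exact ⟨x, R, hR, hx⟩
  have hdir : ∀ {x y x' y'}, S x y → S x' y' → ∃ R : P, R ∈ I ∧ (x, y) ∈ R.1 ∧ (x', y') ∈ R.1 := by
    rintro x y x' y' ⟨R, hR, h⟩ ⟨R', hR', h'⟩
    obtain ⟨Q, hQ, hRQ, hRQ'⟩ := I.directed R hR R' hR'
    exact ⟨Q, hQ, hRQ h, hRQ' h'⟩
  have hmul : ∀ {x y x' y'}, S x y → S x' y' → S (x * x') (y * y') := by
    intro x y x' y' h h'
    obtain ⟨R, hR, h1, h2⟩ := hdir h h'
    exact ⟨R, hR, R.1.mul_mem h1 h2⟩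
  -- Applying `eq_one_iff` to a quotient of two pairs makes `S` both single-valued and injective.
  have hiff : ∀ {x y x' y'}, S x y → S x' y' → (x = x' ↔ y = y') := by
    intro x y x' y' h h'
    obtain ⟨R, -, h1, h2⟩ := hdir h h'
    have := R.2.eq_one_iff _ (R.1.mul_mem h1 (R.1.inv_mem h2))
    simpa [mul_inv_eq_one] using this
  choose f hf using hleft
  choose f' hf' using hright
  let g : MulAut H :=
    { toFun := f
      invFun := f'
      left_inv := fun x => (hiff (hf' (f x)) (hf x)).2 rfl
      right_inv := fun y => (hiff (hf (f' y)) (hf' y)).1 rfl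
      map_mul' := fun x y => (hiff (hf (x * y)) (hmul (hf x) (hf y))).1 rfl }
  refine ⟨g, fun i => ?_⟩
  rw [mul_inv_eq_iff_eq_mul]
  ext x
  obtain ⟨R, hR, h⟩ := hf x
  exact (hiff (hf (φ i x)) ⟨R, hR, R.2.invariant i _ h⟩).1 rfl

end PartialIso

/-! ### The topology of pointwise convergence -/

section Topology

variable {H : Type*} [Group H]

theorem MulAut.isOpen_setOf_apply_eq (x y : H) : IsOpen {φ : MulAut H | φ x = y} := by
  let _ : TopologicalSpace H := ⊥
  have : DiscreteTopology H := ⟨rfl⟩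
  exact ⟨(fun f : H → H => f x) ⁻¹' {y}, (isOpen_discrete {y}).preimage (continuous_apply x), rfl⟩

theorem MulAut.continuous_iff_isOpen {X : Type*} [TopologicalSpace X] {f : X → MulAut H} :
    Continuous f ↔ ∀ x y, IsOpen {a | f a x = y} := by
  refine ⟨fun h x y => (MulAut.isOpen_setOf_apply_eq x y).preimage h, fun h => ?_⟩
  let _ : TopologicalSpace H := ⊥
  have : DiscreteTopology H := ⟨rfl⟩
  exact continuous_induced_rng.2 (continuous_pi fun x => continuous_discrete_rng.2 fun y => h x y)

instance MulAut.isTopologicalGroup : IsTopologicalGroup (MulAut H) where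
  continuous_mul := by
    refine MulAut.continuous_iff_isOpen.2 fun x y => ?_
    have : {p : MulAut H × MulAut H | (p.1 * p.2) x = y} =
        ⋃ z, {φ : MulAut H | φ z = y} ×ˢ {ψ : MulAut H | ψ x = z} := by
      ext p
      simp
    rw [this]
    exact isOpen_iUnion fun z =>
      (MulAut.isOpen_setOf_apply_eq z y).prod (MulAut.isOpen_setOf_apply_eq x z)
  continuous_inv := by
    refine MulAut.continuous_iff_isOpen.2 fun x y => ?_
    have : {φ : MulAut H | φ⁻¹ x = y} = {φ : MulAut H | φ y = x} := by
      ext φ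
      exact φ.symm_apply_eq.trans eq_comm
    rw [this]
    exact MulAut.isOpen_setOf_apply_eq y x

theorem MulAut.polishSpace [Countable H] : PolishSpace (MulAut H) := by
  have hpolish : ∀ (_ : TopologicalSpace H) [DiscreteTopology H], PolishSpace H :=
    fun _ _ => inferInstance
  let _ : TopologicalSpace H := ⊥
  have : DiscreteTopology H := ⟨rfl⟩
  have := hpolish _
  have hind : Topology.IsInducing (fun (φ : MulAut H) (x : H) => φ x) := ⟨rfl⟩
  -- A pointwise limit of automorphisms can fail to be surjective; recording inverses as well makes
  -- the image closed.
  let F : MulAut H → (H → H) × (H → H) := fun φ => (fun x => φ x, fun x => φ⁻¹ x)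
  have hF : Continuous F := hind.continuous.prodMk (hind.continuous.comp continuous_inv)
  have hFind : Topology.IsInducing F := .of_comp hF continuous_fst hind
  have hinj : Function.Injective F := fun φ ψ h => by
    ext x
    exact congrFun (congrArg Prod.fst h) x
  have hrange : Set.range F = (⋂ x, ⋂ y, {p | p.1 x = y ↔ p.2 y = x}) ∩
      ⋂ x, ⋂ y, {p | p.1 (x * y) = p.1 x * p.1 y} := by
    ext p
    simp only [Set.mem_inter_iff, Set.mem_iInter, Set.mem_ofPred_eq]
    constructor
    · rintro ⟨φ, rfl⟩
      exact ⟨fun x y => eq_comm.trans φ.symm_apply_eq.symm, map_mul φ⟩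
    · rintro ⟨h1, h2⟩
      exact ⟨{ toFun := p.1, invFun := p.2, left_inv := fun x => (h1 x _).1 rfl,
               right_inv := fun y => (h1 _ y).2 rfl, map_mul' := h2 }, rfl⟩
  refine Topology.IsClosedEmbedding.polishSpace (f := F) ⟨⟨hFind, hinj⟩, ?_⟩
  rw [hrange]
  have hfst : ∀ x, Continuous fun p : (H → H) × (H → H) => p.1 x :=
    fun x => (continuous_apply x).comp continuous_fst
  have hsnd : ∀ x, Continuous fun p : (H → H) × (H → H) => p.2 x :=
    fun x => (continuous_apply x).comp continuous_snd
  refine IsClosed.inter (isClosed_iInter fun x => isClosed_iInter fun y => ?_)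
    (isClosed_iInter fun x => isClosed_iInter fun y => ?_)
  · exact (isClosed_discrete {q : H × H | q.1 = y ↔ q.2 = x}).preimage ((hfst x).prodMk (hsnd y))
  · exact isClosed_eq (hfst _) ((hfst x).mul (hfst y))

variable {ι : Type*} [Finite ι]

/-- Tuples of automorphisms are close if they agree on a large finite set. -/
theorem MulAut.mem_nhds_pi_iff {φ : ι → MulAut H} {U : Set (ι → MulAut H)} :
    U ∈ nhds φ ↔ ∃ s : Set H, s.Finite ∧
      {ψ : ι → MulAut H | ∀ i, ∀ x ∈ s, ψ i x = φ i x} ⊆ U := by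
  constructor
  · intro hU
    rw [nhds_pi, Filter.mem_pi] at hU
    obtain ⟨I, -, t, ht, hsub⟩ := hU
    let _ : TopologicalSpace H := ⊥
    have : DiscreteTopology H := ⟨rfl⟩
    have key : ∀ i, ∃ s : Set H, s.Finite ∧ ∀ α : MulAut H, (∀ x ∈ s, α x = φ i x) → α ∈ t i := by
      intro i
      obtain ⟨V, hV, hVt⟩ := mem_nhds_induced _ _ _ |>.1 (ht i)
      rw [nhds_pi, Filter.mem_pi] at hV
      obtain ⟨J, hJ, w, hw, hwV⟩ := hV
      refine ⟨J, hJ, fun α hα => hVt (hwV fun x hx => ?_)⟩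
      change α x ∈ w x
      rw [hα x hx]
      exact mem_of_mem_nhds (hw x)
    choose s hs hst using key
    exact ⟨⋃ i, s i, Set.finite_iUnion hs, fun ψ hψ => hsub fun i _ =>
      hst i _ fun x hx => hψ i x (Set.mem_iUnion.2 ⟨i, hx⟩)⟩
  · rintro ⟨s, hs, hsub⟩
    refine Filter.mem_of_superset ?_ hsub
    have : {ψ : ι → MulAut H | ∀ i, ∀ x ∈ s, ψ i x = φ i x} =
        ⋂ i, ⋂ x ∈ s, {ψ | ψ i x = φ i x} := by
      ext ψ
      simp
    rw [this]
    refine (isOpen_iInter_of_finite fun i => hs.isOpen_biInter fun x _ => ?_).mem_nhds (by simp)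
    exact (MulAut.isOpen_setOf_apply_eq x (φ i x)).preimage
      (continuous_apply (A := fun _ : ι => MulAut H) i)

theorem MulAut.mem_residual_pi {U : Set (ι → MulAut H)}
    (hopen : ∀ φ ∈ U, ∃ s : Set H, s.Finite ∧
      ∀ ψ : ι → MulAut H, (∀ i, ∀ x ∈ s, ψ i x = φ i x) → ψ ∈ U)
    (hdense : ∀ (φ : ι → MulAut H) (s : Set H), s.Finite →
      ∃ ψ ∈ U, ∀ i, ∀ x ∈ s, ψ i x = φ i x) : U ∈ residual (ι → MulAut H) := by
  refine residual_of_dense_open (isOpen_iff_mem_nhds.2 fun φ hφ => MulAut.mem_nhds_pi_iff.2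
    (hopen φ hφ)) (dense_iff_inter_open.2 fun V hV ⟨φ, hφ⟩ => ?_)
  obtain ⟨s, hs, hsV⟩ := MulAut.mem_nhds_pi_iff.1 (hV.mem_nhds hφ)
  obtain ⟨ψ, hψU, hψ⟩ := hdense φ s hs
  exact ⟨ψ, hsV hψ, hψU⟩

end Topology

/-! ### Generic tuples are comeager -/

namespace IsHallUniversalGroup

variable {H : Type*} [Group H]

/-- Finitely many automorphisms agree on a finite set with the inner automorphisms given by
elements of a finite subgroup containing that set. -/
theorem exists_inner_approximation {ι : Type*} [Finite ι] (hH : IsHallUniversalGroup H)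
    (φ : ι → MulAut H) {s : Set H} (hs : s.Finite) :
    ∃ C : Subgroup H, Finite C ∧ s ⊆ C ∧
      ∃ g : ι → C, ∀ i, ∀ x ∈ s, g i * x * (g i : H)⁻¹ = φ i x := by
  have := hH.locallyFinite s hs
  choose g hg using fun i => hH.exists_conj_eq (Subgroup.subtype_injective (Subgroup.closure s))
    (v := (φ i).toMonoidHom.comp (Subgroup.closure s).subtype)
    ((φ i).injective.comp (Subgroup.subtype_injective _))
  have hsub := Subgroup.subset_closure (k := s ∪ Set.range g)
  exact ⟨Subgroup.closure (s ∪ Set.range g), hH.locallyFinite _ (hs.union (Set.finite_range g)),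
    fun x hx => hsub (Or.inl hx), fun i => ⟨g i, hsub (Or.inr ⟨i, rfl⟩)⟩,
    fun i x hx => hg i ⟨x, Subgroup.subset_closure hx⟩⟩

/-- Invariance of a finite `C` depends only on values on `C`, which gives openness. Density holds
because inner automorphisms by elements of `C` preserve `C`. -/
theorem setOf_exists_invariant_mem_residual {ι : Type*} [Finite ι] (hH : IsHallUniversalGroup H)
    {s : Set H} (hs : s.Finite) :
    {φ : ι → MulAut H | ∃ C : Subgroup H, Finite C ∧ s ⊆ C ∧ ∀ i, ∀ x ∈ C, φ i x ∈ C} ∈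
      residual (ι → MulAut H) := by
  refine MulAut.mem_residual_pi ?_ ?_
  · rintro φ ⟨C, hC, hsC, hinv⟩
    exact ⟨C, Set.toFinite _, fun ψ hψ => ⟨C, hC, hsC, fun i x hx => by
      rw [hψ i x hx]; exact hinv i x hx⟩⟩
  · intro φ t ht
    obtain ⟨C, hC, htC, g, hg⟩ := hH.exists_inner_approximation φ (hs.union ht)
    refine ⟨fun i => MulAut.conj (g i : H), ⟨C, hC, fun x hx => htC (Or.inl hx), fun i x hx => ?_⟩,
      fun i x hx => hg i x (Or.inr hx)⟩
    exact C.mul_mem (C.mul_mem (g i).2 hx) (C.inv_mem (g i).2)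

/-- Openness: a realization is witnessed on the finite range of `j`, and failure of the premise on
`A`. Density: an inner approximation living in a finite `C` is amalgamated with `B` over `A`. -/
theorem setOf_realizesExtension_mem_residual {ι : Type*} [Finite ι] (hH : IsHallUniversalGroup H)
    (A B : Subgroup H) [Finite B] (b : ι → B) :
    {φ : ι → MulAut H | RealizesExtension A B b φ} ∈ residual (ι → MulAut H) := by
  by_cases hAB : A ≤ B
  swap
  · exact Filter.mem_of_superset Filter.univ_mem fun φ _ h => absurd h hAB
  have hA : (A : Set H).Finite := (Set.toFinite (B : Set H)).subset hAB
  have : Finite A := hA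
  refine MulAut.mem_residual_pi ?_ ?_
  · intro φ hφ
    by_cases h : ∀ i, ∀ a ∈ A, φ i a ∈ A ∧ φ i a = b i * a * (b i : H)⁻¹
    · obtain ⟨j, hj, hjA, hjb⟩ := hφ hAB h
      refine ⟨Set.range j, Set.finite_range j, fun ψ hψ _ _ => ⟨j, hj, hjA, fun i x => ?_⟩⟩
      rw [hψ i _ ⟨x, rfl⟩, hjb]
    · refine ⟨A, hA, fun ψ hψ _ h' => absurd (fun i a ha => ?_) h⟩
      rw [← hψ i a ha]
      exact h' i a ha
  · intro φ t ht
    by_cases h : ∀ i, ∀ a ∈ A, φ i a ∈ A ∧ φ i a = b i * a * (b i : H)⁻¹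
    · obtain ⟨C, hC, htC, g, hg⟩ := hH.exists_inner_approximation φ (hA.union ht)
      have hAC : A ≤ C := fun x hx => htC (Or.inl hx)
      choose α hα using fun i => MulAut.exists_restrict (φ i) A fun a ha => (h i a ha).1
      obtain ⟨k, j, hj, hjA, hkC, hkj⟩ := hH.exists_amalgam (Subgroup.inclusion_injective hAB)
        (Subgroup.inclusion_injective hAC) C.subtype_injective α (b := b) (g := g)
        (fun i a => Subtype.ext ((h i a a.2).2.symm.trans (hα i a).symm))
        (fun i a => Subtype.ext ((hg i a (Or.inl a.2)).trans (hα i a).symm))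
      refine ⟨fun i => MulAut.conj (k i), fun _ _ => ⟨j, hj, fun x hx => hjA ⟨x, hx⟩, hkj⟩,
        fun i x hx => ?_⟩
      exact (hkC i ⟨x, htC (Or.inr hx)⟩).trans (hg i x (Or.inr hx))
    · exact ⟨φ, fun _ h' => absurd h' h, fun _ _ _ => rfl⟩

theorem setOf_isGenericTuple_mem_residual {ι : Type*} [Finite ι] (hH : IsHallUniversalGroup H) :
    {φ : ι → MulAut H | IsGenericTuple φ} ∈ residual (ι → MulAut H) := by
  have := hH.countable
  have hc : Countable {A : Subgroup H // Finite A} := by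
    refine Function.Injective.countable
      (f := fun A : {A : Subgroup H // Finite A} => (Set.Finite.toFinset (s := (A.1 : Set H)) A.2))
      fun A B h => ?_
    exact Subtype.ext (SetLike.coe_injective (Set.Finite.toFinset_inj.1 h))
  have hinv : ∀ᶠ φ in residual (ι → MulAut H), ∀ s : Finset H,
      ∃ C : Subgroup H, Finite C ∧ (s : Set H) ⊆ C ∧ ∀ i, ∀ x ∈ C, φ i x ∈ C :=
    eventually_countable_forall.2 fun s => hH.setOf_exists_invariant_mem_residual s.finite_toSet
  have hext : ∀ᶠ φ in residual (ι → MulAut H), ∀ A B : {A : Subgroup H // Finite A},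
      ∀ b : ι → B.1, RealizesExtension A.1 B.1 b φ :=
    eventually_countable_forall.2 fun A => eventually_countable_forall.2 fun B =>
      eventually_countable_forall.2 fun b =>
        have := B.2
        hH.setOf_realizesExtension_mem_residual A.1 B.1 b
  filter_upwards [hinv, hext] with φ h1 h2
  refine ⟨fun s hs => ?_, fun A B hB b hAB => ?_⟩
  · obtain ⟨C, hC⟩ := h1 hs.toFinset
    exact ⟨C, by simpa using hC⟩
  · have : Finite A := Finite.of_injective _ (Subgroup.inclusion_injective hAB)
    exact h2 ⟨A, this⟩ ⟨B, hB⟩ b hAB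

theorem hasAmpleGenerics (hH : IsHallUniversalGroup H) : HasAmpleGenerics (MulAut H) := by
  have := hH.countable
  have : PolishSpace (MulAut H) := MulAut.polishSpace
  refine ⟨inferInstance, inferInstance, fun n => ?_⟩
  have hres := hH.setOf_isGenericTuple_mem_residual (ι := Fin n)
  -- Complete metrizability makes Baire's theorem available, which supplies a generic tuple.
  let _ := TopologicalSpace.upgradeIsCompletelyMetrizable (Fin n → MulAut H)
  obtain ⟨φ, hφ⟩ := (dense_of_mem_residual hres).nonempty
  refine ⟨φ, Filter.mem_of_superset hres fun ψ hψ => ?_⟩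
  obtain ⟨g, hg⟩ := hφ.exists_conj hH hψ
  exact ⟨g, funext hg⟩

end IsHallUniversalGroup

theorem mainTheorem1 :
    (∃ (H : Type) (_ : Group H), IsHallUniversalGroup H) ∧
    ∀ (H : Type*) [Group H], IsHallUniversalGroup H → HasAmpleGenerics (MulAut H) :=
  ⟨⟨HallGroup, inferInstance, HallGroup.isHallUniversalGroup⟩, fun _ _ hH => hH.hasAmpleGenerics⟩
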